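/- A binary sequence is a finite sequence of $0$s and $1$s; $2^{<m}$ is the set of those of length less than $m$, $\eta\subseteq\eta'$ means that $\eta$ is an initial segment of $\eta'$, and $\eta\wedge j$ is $\eta$ with the digit $j$ appended. Let $G=(V,E)$ be a finite simple graph with $|V|=n$. A \emph{type tree} for $G$ is a labeling $V=\{a_\eta \mid \eta\in A\}$, each vertex being used exactly once, by a set $A\subseteq 2^{<n}$ closed under initial segments, such that (1) for $\eta\in A$: if $\eta\wedge 0\in A$, then $a_{\eta\wedge 0}$ is not adjacent to $a_\eta$; if $\eta\wedge 1\in A$, then $a_{\eta\wedge 1}$ is adjacent to $a_\eta$; (2) if $\eta\subsetneq\eta'\subsetneq\eta''$ are in $A$, then $a_\eta$ is adjacent to $a_{\eta'}$ if and only if $a_\eta$ is adjacent to $a_{\eta''}$. It has \emph{height} $h$ if $A\subseteq 2^{<h}$ but $A\not\subseteq 2^{<h-1}$. The \emph{tree rank} of $G$ is the largest integer $t$ such that for some $V'\subseteq V$ the induced graph on $V'$ has a type tree with index set $2^{<t}$. **Theorem.** Let $G=(V,E)$ be a finite simple graph with $|V|=n$ and tree rank $t\ge 2$. Suppose that $A\subseteq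 2^{<n}$ and $V=\{a_\eta\mid\eta\in A\}$ is a type tree of height $h$, where $h\ge 2t$. Then, unless $(t,h,n)=(2,4,10)$, $$h\ \ge\ \bigl(n\cdot (t-2)!\bigr)^{1/t}+1 .$$ Moreover, in all cases (including $(t,h,n)=(2,4,10)$), $G$ has a clique or an independent set of size at least $$\frac{\bigl(n\cdot (t-2)!\bigr)^{1/t}+1}{2}.$$ -/

import Mathlib

namespace TypeTree

/-- The set `2^{<n}` of binary sequences of length less than `n`
(`false` is the digit `0` and `true` is the digit `1`). -/
def binSeqLT (n : ℕ) : Set (List Bool) := {η | η.length < n}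

/-- `V = {a_η | η ∈ A}` is a type tree for the graph `G` on `V`: `A` is a set of binary sequences
of length less than `|V|` closed under initial segments, `a` labels the vertices of `G` by the
elements of `A` (each vertex exactly once), and the adjacency conditions below hold. -/
structure IsTypeTree {V : Type*} (G : SimpleGraph V) (A : Set (List Bool)) (a : A → V) : Prop where
  subset_binSeqLT : A ⊆ binSeqLT (Nat.card V)
  prefix_mem : ∀ η ∈ A, ∀ ζ : List Bool, ζ <+: η → ζ ∈ A
  bijective : Function.Bijective a
  /-- If `η ∧ 0 ∈ A`, then `a_{η ∧ 0}` is nonadjacent to `a_η`. -/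
  not_adj_of_append_false : ∀ η ζ : A, (ζ : List Bool) = (η : List Bool) ++ [false] →
    ¬ G.Adj (a ζ) (a η)
  /-- If `η ∧ 1 ∈ A`, then `a_{η ∧ 1}` is adjacent to `a_η`. -/
  adj_of_append_true : ∀ η ζ : A, (ζ : List Bool) = (η : List Bool) ++ [true] →
    G.Adj (a ζ) (a η)
  /-- If `η ⊊ ζ ⊊ ξ` in `A`, then `a_η` is adjacent to `a_ζ` iff it is adjacent to `a_ξ`. -/
  adj_iff_adj : ∀ η ζ ξ : A,
    (η : List Bool) <+: (ζ : List Bool) → η ≠ ζ →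
    (ζ : List Bool) <+: (ξ : List Bool) → ζ ≠ ξ →
    (G.Adj (a η) (a ζ) ↔ G.Adj (a η) (a ξ))

/-- The index set `A` of a type tree has height `h` (for `h ≥ 1`):
`A ⊆ 2^{<h}` but `A ⊈ 2^{<h-1}`. -/
def HasHeight (A : Set (List Bool)) (h : ℕ) : Prop :=
  A ⊆ binSeqLT h ∧ ¬ A ⊆ binSeqLT (h - 1)

/-- The graph `G` has tree rank `t`: `t` is the largest integer such that some induced subgraph
of `G` has a type tree whose index set is all of `2^{<t}`. -/
def HasTreeRank {V : Type*} (G : SimpleGraph V) (t : ℕ) : Prop :=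
  IsGreatest {s : ℕ | ∃ (W : Set V) (a : binSeqLT s → W),
    IsTypeTree (G.induce W) (binSeqLT s) a} t

end TypeTree

namespace TypeTree

/-! For comparable indices, adjacency is decided by the first digit at which the longer one leaves
the shorter; this has two consequences. Counting: a branching-compatible copy of `2^{<t+1}` inside
`A` would carry an induced type tree of that shape, so tree rank `t` forbids it. A Pascal-type
recursion on height then gives n ≤ ∑_{i=1}^t C(h,i), which for h ≥ 2t is at most (h-1)^t/(t-2)!
outside the exceptional case. Homogeneous sets: on a branch with h vertices, those followed by the
same digit form a clique or an independent set. The last vertex fits both classes, so one class has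
at least (h+1)/2 elements; the spare 1/2 absorbs the exceptional case. -/

/-- In a type tree, whether `a_η` is adjacent to a vertex above `η ∧ j` is decided by `j`. -/
theorem IsTypeTree.adj_iff {V : Type*} {G : SimpleGraph V} {A : Set (List Bool)} {a : A → V}
    (h : IsTypeTree G A a) (η ξ : A) (j : Bool)
    (hp : (η : List Bool) ++ [j] <+: (ξ : List Bool)) :
    G.Adj (a η) (a ξ) ↔ j = true := by
  have hmem : (η : List Bool) ++ [j] ∈ A := h.prefix_mem _ ξ.2 _ hp
  have base : G.Adj (a η) (a ⟨_, hmem⟩) ↔ j = true := by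
    cases j with
    | false => simpa [G.adj_comm] using h.not_adj_of_append_false η ⟨_, hmem⟩ rfl
    | true => simpa [G.adj_comm] using h.adj_of_append_true η ⟨_, hmem⟩ rfl
  by_cases he : (⟨_, hmem⟩ : A) = ξ
  · rw [← he]; exact base
  · rw [← base]
    refine (h.adj_iff_adj η ⟨_, hmem⟩ ξ (List.prefix_append _ _) (fun e => ?_) hp he).symm
    have := congrArg (fun x : A => (x : List Bool).length) e
    simp at this

/-- The part of `A` above `η` contains a copy of the full binary tree `2^{<s}` in which the two
subtrees at every node lie above its two immediate successors. -/
def ContainsFullTree (A : Set (List Bool)) : ℕ → List Bool → Prop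
  | 0, _ => True
  | s + 1, η => ∃ ζ ∈ A, η <+: ζ ∧ ∀ j, ContainsFullTree A s (ζ ++ [j])

theorem ContainsFullTree.mono_prefix {A : Set (List Bool)} {s : ℕ} {η ζ : List Bool}
    (hp : η <+: ζ) (h : ContainsFullTree A s ζ) : ContainsFullTree A s η := by
  cases s with
  | zero => trivial
  | succ s =>
    obtain ⟨ξ, hξ, hpr, hj⟩ := h
    exact ⟨ξ, hξ, hp.trans hpr, hj⟩

/-- A prefix-closed set of height `h` above `η` not containing the full tree `2^{<t+1}` there has
at most `∑_{i=1}^t (h choose i)` elements above `η`. -/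
theorem ncard_le_of_not_containsFullTree {A : Set (List Bool)}
    (hA : ∀ η ∈ A, ∀ ζ : List Bool, ζ <+: η → ζ ∈ A) (h : ℕ) :
    ∀ (t : ℕ) (η : List Bool), A ⊆ binSeqLT (η.length + h) → ¬ ContainsFullTree A (t + 1) η →
      {ξ ∈ A | η <+: ξ}.ncard ≤ ∑ i ∈ Finset.range t, h.choose (i + 1) := by
  induction h with
  | zero =>
    intro t η hsub _
    have : {ξ ∈ A | η <+: ξ} = ∅ := by
      ext ξ
      simp only [Set.mem_ofPred_eq, Set.mem_empty_iff_false, iff_false, not_and]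
      intro hξ hp
      have h1 : ξ.length < η.length + 0 := hsub hξ
      have := hp.length_le
      omega
    simp [this]
  | succ h ih =>
    intro t η hsub hnot
    by_cases hη : η ∈ A
    swap
    · have : {ξ ∈ A | η <+: ξ} = ∅ := by
        ext ξ
        simp only [Set.mem_ofPred_eq, Set.mem_empty_iff_false, iff_false, not_and]
        exact fun hξ hp => hη (hA ξ hξ η hp)
      simp [this]
    cases t with
    | zero => exact absurd ⟨η, hη, List.prefix_refl _, fun _ => trivial⟩ hnot
    | succ t =>
      have hsub' : ∀ j, A ⊆ binSeqLT ((η ++ [j]).length + h) := by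
        intro j
        have : (η ++ [j]).length + h = η.length + (h + 1) := by simp; omega
        rwa [this]
      have hlarge : ∀ j, {ξ ∈ A | η ++ [j] <+: ξ}.ncard ≤
          ∑ i ∈ Finset.range (t + 1), h.choose (i + 1) := fun j =>
        ih (t + 1) _ (hsub' j) fun hc => hnot (hc.mono_prefix (List.prefix_append _ _))
      -- Full trees of height `t + 1` on both sides would join under `η` into one of height `t + 2`;
      -- so one side satisfies the bound for a smaller rank.
      obtain ⟨j, hj⟩ : ∃ j, ¬ ContainsFullTree A (t + 1) (η ++ [j]) := by
        by_contra hc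
        push Not at hc
        exact hnot ⟨η, hη, List.prefix_refl _, hc⟩
      have hsmall := ih t _ (hsub' j) hj
      have hcover : {ξ ∈ A | η <+: ξ} ⊆
          ({η} ∪ {ξ ∈ A | η ++ [j] <+: ξ}) ∪ {ξ ∈ A | η ++ [!j] <+: ξ} := by
        rintro ξ ⟨hξ, r, rfl⟩
        rcases r with _ | ⟨b, r⟩
        · simp
        · have hb : η ++ [b] <+: η ++ b :: r := ⟨r, by simp⟩
          rcases Bool.eq_or_eq_not b j with rfl | rfl
          · exact Or.inl (Or.inr ⟨hξ, hb⟩)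
          · exact Or.inr ⟨hξ, hb⟩
      have hfin : A.Finite :=
        (List.finite_length_lt Bool (η.length + (h + 1))).subset hsub
      have h1 := Set.ncard_le_ncard hcover
        (((Set.finite_singleton η).union (hfin.subset (Set.sep_subset _ _))).union
          (hfin.subset (Set.sep_subset _ _)))
      have h2 := Set.ncard_union_le ({η} ∪ {ξ ∈ A | η ++ [j] <+: ξ}) {ξ ∈ A | η ++ [!j] <+: ξ}
      have h3 := Set.ncard_union_le {η} {ξ ∈ A | η ++ [j] <+: ξ}
      rw [Set.ncard_singleton] at h3
      have h4 := hlarge (!j)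
      -- Pascal's rule summed over `i`; the 1 that counts `η` is `h.choose 0`.
      have h5 : ∑ i ∈ Finset.range (t + 1), (h + 1).choose (i + 1) =
          (1 + ∑ i ∈ Finset.range t, h.choose (i + 1)) +
            ∑ i ∈ Finset.range (t + 1), h.choose (i + 1) := by
        simp only [Nat.choose_succ_succ, Finset.sum_add_distrib]
        rw [Finset.sum_range_succ' (fun i => h.choose i)]
        simp [add_comm]
      omega

/-- A copy of the full binary tree is given by an injective map compatible with branching. -/
theorem ContainsFullTree.exists_map {A : Set (List Bool)} {s : ℕ} {η : List Bool}
    (h : ContainsFullTree A s η) :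
    ∃ f : List Bool → List Bool,
      (∀ ξ ∈ binSeqLT s, f ξ ∈ A ∧ η <+: f ξ) ∧ Set.InjOn f (binSeqLT s) ∧
      ∀ ξ j ρ, ξ ++ j :: ρ ∈ binSeqLT s → f ξ ++ [j] <+: f (ξ ++ j :: ρ) := by
  induction s generalizing η with
  | zero => exact ⟨id, by simp [binSeqLT], by simp [binSeqLT], by simp [binSeqLT]⟩
  | succ s ih =>
    obtain ⟨ζ, hζ, hp, hj⟩ := h
    choose g hgA hgi hgb using fun j => ih (hj j)
    have hcons : ∀ {b : Bool} {ξ : List Bool}, b :: ξ ∈ binSeqLT (s + 1) → ξ ∈ binSeqLT s := by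
      simp [binSeqLT]
    refine ⟨fun ξ => match ξ with | [] => ζ | b :: ξ => g b ξ, ?_, ?_, ?_⟩
    · rintro (_ | ⟨b, ξ⟩) hξ
      · exact ⟨hζ, hp⟩
      · obtain ⟨h1, h2⟩ := hgA b ξ (hcons hξ)
        exact ⟨h1, (hp.trans (List.prefix_append _ _)).trans h2⟩
    · rintro (_ | ⟨b, ξ⟩) hξ (_ | ⟨c, ρ⟩) hρ e
      · rfl
      · have h1 := (hgA c ρ (hcons hρ)).2.length_le
        have h2 : ζ = g c ρ := e
        rw [← h2] at h1
        simp at h1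
      · have h1 := (hgA b ξ (hcons hξ)).2.length_le
        have h2 : g b ξ = ζ := e
        rw [h2] at h1
        simp at h1
      · have h2 : g b ξ = g c ρ := e
        have h3 := (hgA b ξ (hcons hξ)).2
        have h4 := (hgA c ρ (hcons hρ)).2
        rw [← h2] at h4
        have h5 : ζ ++ [b] = ζ ++ [c] :=
          (List.prefix_of_prefix_length_le h3 h4 (by simp)).eq_of_length (by simp)
        obtain rfl : b = c := by simpa using h5
        rw [hgi b (hcons hξ) (hcons hρ) h2]
    · rintro (_ | ⟨b, ξ⟩) j ρ hm
      · exact (hgA j ρ (hcons hm)).2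
      · exact hgb b ξ j ρ (hcons hm)

/-- A full binary tree inside the index set of a type tree yields an induced subgraph with a
type tree indexed by `2^{<s}`. -/
theorem IsTypeTree.exists_induce_of_containsFullTree {V : Type*} [Finite V] {G : SimpleGraph V}
    {A : Set (List Bool)} {a : A → V} (h : IsTypeTree G A a) {s : ℕ} {η : List Bool}
    (hs : ContainsFullTree A s η) :
    ∃ (W : Set V) (b : binSeqLT s → W), IsTypeTree (G.induce W) (binSeqLT s) b := by
  obtain ⟨f, hfA, hfi, hfb⟩ := hs.exists_map
  let F : binSeqLT s → A := fun ξ => ⟨f ξ, (hfA ξ ξ.2).1⟩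
  have hF : Function.Injective (a ∘ F) := by
    refine h.bijective.1.comp fun x y e => Subtype.ext (hfi x.2 y.2 ?_)
    exact congrArg Subtype.val e
  let b : binSeqLT s → Set.range (a ∘ F) := Set.rangeFactorization (a ∘ F)
  have hb : Function.Bijective b :=
    ⟨fun x y e => hF (congrArg Subtype.val e), Set.rangeFactorization_surjective⟩
  have hadj : ∀ (ξ ξ' : binSeqLT s) (j : Bool) (ρ : List Bool),
      (ξ' : List Bool) = (ξ : List Bool) ++ j :: ρ →
      ((G.induce (Set.range (a ∘ F))).Adj (b ξ) (b ξ') ↔ j = true) := by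
    intro ξ ξ' j ρ e
    refine h.adj_iff (F ξ) (F ξ') j ?_
    have h1 := hfb ξ j ρ (e ▸ ξ'.2)
    rwa [← e] at h1
  refine ⟨_, b, ⟨?_, ?_, hb, ?_, ?_, ?_⟩⟩
  · have hcard : s ≤ Nat.card (Set.range (a ∘ F)) := by
      have hinj : Function.Injective
          (fun i : Fin s => b ⟨List.replicate i false, by simp [binSeqLT]⟩) := by
        intro i k e
        have h1 := congrArg (fun x : binSeqLT s => (x : List Bool).length) (hb.1 e)
        exact Fin.ext (by simpa using h1)
      simpa using Nat.card_le_card_of_injective _ hinj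
    exact fun ξ hξ => lt_of_lt_of_le hξ hcard
  · exact fun ξ hξ ζ hp => lt_of_le_of_lt hp.length_le hξ
  · intro ξ ξ' e
    rw [SimpleGraph.adj_comm, hadj ξ ξ' false [] e]
    simp
  · intro ξ ξ' e
    rw [SimpleGraph.adj_comm, hadj ξ ξ' true [] e]
  · rintro ⟨ξ, hξ⟩ ⟨ζ, hζ⟩ ⟨ρ, hρ⟩ ⟨r, rfl⟩ hne ⟨r', rfl⟩ -
    rcases r with _ | ⟨j, r⟩
    · simp at hne
    · rw [hadj ⟨ξ, hξ⟩ ⟨_, hζ⟩ j r rfl, hadj ⟨ξ, hξ⟩ ⟨_, hρ⟩ j (r ++ r') (by simp)]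

/-- A graph of tree rank `t` with a type tree of height `h` has at most `∑_{i=1}^t (h choose i)`
vertices. -/
theorem IsTypeTree.card_le {V : Type*} [Finite V] {G : SimpleGraph V} {A : Set (List Bool)}
    {a : A → V} (h : IsTypeTree G A a) {t m : ℕ} (hrank : HasTreeRank G t)
    (hm : A ⊆ binSeqLT m) :
    Nat.card V ≤ ∑ i ∈ Finset.range t, m.choose (i + 1) := by
  have hnot : ¬ ContainsFullTree A (t + 1) [] := fun hc =>
    absurd (hrank.2 (h.exists_induce_of_containsFullTree hc)) (by simp)
  have h1 := ncard_le_of_not_containsFullTree h.prefix_mem m t [] (by simpa using hm) hnot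
  rw [← Nat.card_congr (Equiv.ofBijective a h.bijective)]
  simpa using h1

/-- More than half of the vertices on any branch of a type tree form a clique or an independent
set. -/
theorem IsTypeTree.exists_isClique_or_isIndepSet {V : Type*} {G : SimpleGraph V}
    {A : Set (List Bool)} {a : A → V} (h : IsTypeTree G A a) {η : List Bool} (hη : η ∈ A) :
    ∃ s : Finset V, (G.IsClique (s : Set V) ∨ G.IsIndepSet (s : Set V)) ∧
      η.length + 2 ≤ 2 * s.card := by
  classical
  let p : ℕ → A := fun i => ⟨η.take i, h.prefix_mem η hη _ (List.take_prefix _ _)⟩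
  have hadj : ∀ i k j, i < k → k ≤ η.length → η[i]? = some j →
      (G.Adj (a (p i)) (a (p k)) ↔ j = true) := by
    intro i k j hik hk hj
    refine h.adj_iff (p i) (p k) j ?_
    have h1 : η.take (i + 1) = η.take i ++ [j] := by
      rw [List.take_add_one, hj]; rfl
    change η.take i ++ [j] <+: η.take k
    rw [← h1]
    exact List.take_prefix_take_left (by omega)
  -- The top vertex has no next digit, so it is put in both classes; this double count gives the `+
  -- 2`.
  let I : Bool → Finset ℕ := fun j =>
    (Finset.range (η.length + 1)).filter fun i => i = η.length ∨ η[i]? = some j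
  have hI : ∀ j i, i ∈ I j → i ≤ η.length ∧ (i < η.length → η[i]? = some j) := by
    intro j i hi
    simp only [I, Finset.mem_filter, Finset.mem_range] at hi
    exact ⟨by omega, fun hlt => hi.2.resolve_left (by omega)⟩
  have hinj : ∀ j, Set.InjOn (fun i => a (p i)) (I j) := by
    intro j i hi k hk e
    have h1 := congrArg (fun x : A => (x : List Bool).length) (h.bijective.1 e)
    have h2 := (hI j i hi).1
    have h3 := (hI j k hk).1
    simpa [p, h2, h3] using h1
  have hpair : ∀ j, ∀ i ∈ I j, ∀ k ∈ I j, i ≠ k →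
      (G.Adj (a (p i)) (a (p k)) ↔ j = true) := by
    intro j i hi k hk hne
    have h2 := hI j i hi
    have h3 := hI j k hk
    rcases lt_or_gt_of_ne hne with hlt | hlt
    · exact hadj i k j hlt h3.1 (h2.2 (by omega))
    · rw [G.adj_comm]
      exact hadj k i j hlt h2.1 (h3.2 (by omega))
  have hcard : η.length + 2 ≤ (I true).card + (I false).card := by
    rw [← Finset.card_union_add_card_inter]
    have h1 : Finset.range (η.length + 1) ⊆ I true ∪ I false := by
      intro i hi
      have hi' := Finset.mem_range.1 hi
      simp only [I, Finset.mem_union, Finset.mem_filter, hi, true_and]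
      rcases Nat.lt_or_ge i η.length with hlt | hge
      · rw [List.getElem?_eq_getElem hlt]
        cases η[i] <;> simp
      · exact Or.inl (Or.inl (by omega))
    have h2 : {η.length} ⊆ I true ∩ I false := by simp [I]
    have h3 := Finset.card_le_card h1
    have h4 := Finset.card_le_card h2
    rw [Finset.card_range] at h3
    rw [Finset.card_singleton] at h4
    omega
  obtain ⟨j, hj⟩ : ∃ j, η.length + 2 ≤ 2 * (I j).card := by
    rcases le_total (I true).card (I false).card with hle | hle
    · exact ⟨false, by omega⟩
    · exact ⟨true, by omega⟩
  refine ⟨(I j).image fun i => a (p i), ?_, by rwa [Finset.card_image_of_injOn (hinj j)]⟩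
  cases j with
  | true =>
    left
    intro x hx y hy hne
    obtain ⟨i, hi, rfl⟩ := Finset.mem_image.1 (Finset.mem_coe.1 hx)
    obtain ⟨k, hk, rfl⟩ := Finset.mem_image.1 (Finset.mem_coe.1 hy)
    exact (hpair true i hi k hk fun e => hne (by rw [e])).2 rfl
  | false =>
    right
    intro x hx y hy hne
    obtain ⟨i, hi, rfl⟩ := Finset.mem_image.1 (Finset.mem_coe.1 hx)
    obtain ⟨k, hk, rfl⟩ := Finset.mem_image.1 (Finset.mem_coe.1 hy)
    simp [hpair false i hi k hk fun e => hne (by rw [e])]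

/-! ### Numerical estimates -/

/-- By m(m-2) ≤ (m-1)², the factor m is compensated by m-2, which is present only from `t = 3` on.
-/
theorem descFactorial_le_pred_pow {m t : ℕ} (ht : 3 ≤ t) (htm : t ≤ m) :
    m.descFactorial t ≤ (m - 1) ^ t := by
  obtain ⟨k, rfl⟩ := Nat.exists_eq_add_of_le' ht
  obtain ⟨l, rfl⟩ := Nat.exists_eq_add_of_le' (ht.trans htm)
  have h1 : (l + 3).descFactorial (k + 3) = (l + 3) * ((l + 2) * ((l + 1) * l.descFactorial k)) := by
    rw [Nat.succ_descFactorial_succ, Nat.succ_descFactorial_succ, Nat.succ_descFactorial_succ]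
  have h2 : l.descFactorial k ≤ (l + 2) ^ k :=
    (Nat.descFactorial_le_pow l k).trans (Nat.pow_le_pow_left (by omega) k)
  calc (l + 3).descFactorial (k + 3)
      = ((l + 3) * (l + 1)) * (l + 2) * l.descFactorial k := by rw [h1]; ring
    _ ≤ (l + 2) ^ 2 * (l + 2) * (l + 2) ^ k := by gcongr; nlinarith
    _ = (l + 3 - 1) ^ (k + 3) := by
        rw [show l + 3 - 1 = l + 2 by omega]; ring

/-- For `t ≥ 3` and `m ≥ 2t`, `∑_{i=1}^t (m choose i) · (t-2)! ≤ (m-1)^t`. -/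
theorem sum_choose_mul_factorial_le {m t : ℕ} (ht : 3 ≤ t) (hm : 2 * t ≤ m) :
    (∑ i ∈ Finset.range t, m.choose (i + 1)) * (t - 2).factorial ≤ (m - 1) ^ t := by
  -- Binomial coefficients increase up to the middle, and t ≤ m/2.
  have h1 : ∑ i ∈ Finset.range t, m.choose (i + 1) ≤ t * m.choose t := by
    have : ∀ i ∈ Finset.range t, m.choose (i + 1) ≤ m.choose t := by
      intro i hi
      have hi' := Finset.mem_range.1 hi
      have hmono : ∀ k, k ≤ t → ∀ l, l ≤ k → m.choose l ≤ m.choose k := by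
        intro k
        induction k with
        | zero => intro _ l hl; rw [Nat.le_zero.1 hl]
        | succ k ih =>
          intro hk l hl
          rcases Nat.lt_or_ge k l with h | h
          · rw [show l = k + 1 by omega]
          · exact (ih (by omega) l h).trans (Nat.choose_le_succ_of_lt_half_left (by omega))
      exact hmono t le_rfl _ (by omega)
    simpa using Finset.sum_le_card_nsmul _ _ _ this
  have h2 : t * (t - 2).factorial ≤ t.factorial := by
    obtain ⟨k, rfl⟩ := Nat.exists_eq_add_of_le' ht
    rw [Nat.factorial_succ (k + 2)]
    exact Nat.mul_le_mul_left _ (Nat.factorial_le (by omega))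
  calc (∑ i ∈ Finset.range t, m.choose (i + 1)) * (t - 2).factorial
      ≤ (t * m.choose t) * (t - 2).factorial := Nat.mul_le_mul_right _ h1
    _ = (t * (t - 2).factorial) * m.choose t := by ring
    _ ≤ t.factorial * m.choose t := Nat.mul_le_mul_right _ h2
    _ = m.descFactorial t := (Nat.descFactorial_eq_factorial_mul_choose m t).symm
    _ ≤ (m - 1) ^ t := descFactorial_le_pred_pow ht (by omega)

/-- For `t = 2` the claim becomes m(m+1)/2 ≤ (m-1)², true from m = 5 on; at m = 4 it reads 10 ≤ 9,
so only n = 10 fails. -/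
theorem mul_factorial_le_pred_pow {n t m : ℕ} (ht : 2 ≤ t) (hm : 2 * t ≤ m)
    (hn : n ≤ ∑ i ∈ Finset.range t, m.choose (i + 1)) (hex : ¬ (t = 2 ∧ m = 4 ∧ n = 10)) :
    n * (t - 2).factorial ≤ (m - 1) ^ t := by
  rcases ht.eq_or_lt with rfl | ht3
  · simp only [Finset.sum_range_succ, Finset.sum_range_zero, zero_add, Nat.choose_one_right] at hn
    rcases hm.eq_or_lt with rfl | hm5
    · have : n ≤ 10 := hn
      have : n ≠ 10 := fun e => hex ⟨rfl, rfl, e⟩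
      norm_num
      omega
    · obtain ⟨k, rfl⟩ := Nat.exists_eq_add_of_le' (show 5 ≤ m by omega)
      have h1 : (k + 5).choose (1 + 1) * 2 = (k + 5) * (k + 4) := by
        rw [Nat.choose_two_right]
        exact Nat.div_mul_cancel (by simpa [mul_comm] using (Nat.even_mul_succ_self (k + 4)).two_dvd)
      simp only [Nat.sub_self, Nat.factorial_zero, mul_one]
      rw [show k + 5 - 1 = k + 4 by omega]
      nlinarith
  · exact (Nat.mul_le_mul_right _ hn).trans (sum_choose_mul_factorial_le ht3 hm)

end TypeTree

theorem mainTheorem6 {V : Type*} [Finite V] (G : SimpleGraph V) (n t h : ℕ)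
    (hn : Nat.card V = n) (ht : 2 ≤ t) (hrank : TypeTree.HasTreeRank G t)
    (A : Set (List Bool)) (a : A → V) (htree : TypeTree.IsTypeTree G A a)
    (hheight : TypeTree.HasHeight A h) (hh : 2 * t ≤ h) :
    (¬ (t = 2 ∧ h = 4 ∧ n = 10) →
      (h : ℝ) ≥ ((n : ℝ) * (Nat.factorial (t - 2) : ℝ)) ^ (1 / (t : ℝ)) + 1) ∧
    (∃ s : Finset V, (G.IsClique (s : Set V) ∨ G.IsIndepSet (s : Set V)) ∧
      (s.card : ℝ) ≥
        (((n : ℝ) * (Nat.factorial (t - 2) : ℝ)) ^ (1 / (t : ℝ)) + 1) / 2) := by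
  have hroot : ∀ m : ℕ, n * (t - 2).factorial ≤ m ^ t →
      ((n : ℝ) * (Nat.factorial (t - 2) : ℝ)) ^ (1 / (t : ℝ)) ≤ m := by
    intro m hm
    rw [one_div, Real.rpow_inv_le_iff_of_pos (by positivity) (by positivity)
      (by exact_mod_cast (by omega : 0 < t)), Real.rpow_natCast]
    exact_mod_cast hm
  have hbound := htree.card_le hrank hheight.1
  rw [hn] at hbound
  have hfirst : ¬ (t = 2 ∧ h = 4 ∧ n = 10) →
      (h : ℝ) ≥ ((n : ℝ) * (Nat.factorial (t - 2) : ℝ)) ^ (1 / (t : ℝ)) + 1 := by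
    intro hex
    have h1 := hroot (h - 1) (TypeTree.mul_factorial_le_pred_pow ht hh hbound hex)
    rw [Nat.cast_sub (by omega), Nat.cast_one] at h1
    linarith
  refine ⟨hfirst, ?_⟩
  obtain ⟨η, hη, hlen⟩ := Set.not_subset.1 hheight.2
  obtain ⟨s, hs, hcard⟩ := htree.exists_isClique_or_isIndepSet hη
  refine ⟨s, hs, ?_⟩
  have hlen' : h - 1 ≤ η.length := not_lt.1 hlen
  have h2 : (h : ℝ) + 1 ≤ 2 * s.card := by
    exact_mod_cast (by omega : h + 1 ≤ 2 * s.card)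
  by_cases hex : t = 2 ∧ h = 4 ∧ n = 10
  -- Since 10 ≤ 4², the root is at most 4, and h + 1 = 5 suffices.
  · have h1 := hroot 4 (by obtain ⟨rfl, -, rfl⟩ := hex; decide)
    rw [hex.2.1] at h2
    push_cast at h1 h2
    linarith
  · have := hfirst hex
    linarith
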